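/- Let $X_1,X_2,\ldots$ be independent random variables, each uniformly distributed on $\{1,2,\ldots,6\}$, let $S_n=X_1+\cdots+X_n$, and let $\tau=\min\{n\ge 1 : S_n \text{ is prime}\}$ (with $\tau=\infty$ if no $S_n$ is prime). Then $\tau$ is almost surely finite and has finite second moment; in particular its expectation and variance are finite. Moreover, $$|E(\tau)-2.428497913693504|<10^{-7},\qquad |\mathrm{Var}(\tau)-6.242778668279075|<10^{-4},$$ and $2.42849\le E(\tau)<2.42850$ and $6.2427\le \mathrm{Var}(\tau)<6.2428$; that is, $E(\tau)=2.42849\ldots$ and $\mathrm{Var}(\tau)=6.2427\ldots$. -/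

import Mathlib

open MeasureTheory ProbabilityTheory

/-- The total after `n` rolls, `S_n = X_1 + ⋯ + X_n`. The `(i+1)`-st roll is `X i`. -/
def rollSum {Ω : Type*} (X : ℕ → Ω → ℕ) (n : ℕ) (ω : Ω) : ℕ :=
  ∑ i ∈ Finset.range n, X i ω

/-- The first `n ≥ 1` for which `S_n` is prime, and `⊤` if there is no such `n`. -/
noncomputable def primeHit {Ω : Type*} (X : ℕ → Ω → ℕ) : Ω → ℕ∞ :=
  hittingAfter (rollSum X) {p : ℕ | p.Prime} 1

/-- The hitting time as a real random variable (with value `0` where it is infinite). -/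
noncomputable def primeHitReal {Ω : Type*} (X : ℕ → Ω → ℕ) (ω : Ω) : ℝ :=
  ((primeHit X ω).toNat : ℝ)

/-! ### Recursions for expected visits, and decay of the survival probability -/

open scoped NNReal ENNReal

/-! Everything follows from tail sums: `E τ = ∑ P(τ > n)` and `E τ² = ∑ (2n + 1) P(τ > n)`.
Splitting `{τ > n}` by the value of `S_n` and summing over `n` first turns these into `∑ aliveMass`
and `∑ (2 aliveMoment + aliveMass)` over sites. Conditioning on the last roll gives six-term
recursions in the site alone (`tsum_measure_aliveAt`, `tsum_mul_measure_aliveAt`). Indices are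
shifted by 5 so that the start 0 has five empty sites before it.

The recursions are evaluated exactly in integers up to index 1029 (`evaluation_bounds`). For the
tail, passing a prime multiplies the survival probability by at most 5/6, so `crossingMass s * (6/5)
^ π(s)` is nonincreasing. Chebyshev's lower bound for `π` then yields decay faster than `s ^ (-4)`
beyond 1024, which makes the tails of both sums smaller than `10 ^ (-8)`. -/

/-- The expected number of visits to the site `s - 5` before a prime is hit. -/
noncomputable def aliveMass : ℕ → ℝ≥0
  | 0 => 0
  | 1 => 0
  | 2 => 0
  | 3 => 0
  | 4 => 0
  | 5 => 1
  | s + 6 => if (s + 1).Prime then 0 else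
      (aliveMass s + aliveMass (s + 1) + aliveMass (s + 2) + aliveMass (s + 3) + aliveMass (s + 4)
        + aliveMass (s + 5)) / 6

/-- The expected sum of the times of the visits to the site `s - 5` before a prime is hit. -/
noncomputable def aliveMoment : ℕ → ℝ≥0
  | 0 => 0
  | 1 => 0
  | 2 => 0
  | 3 => 0
  | 4 => 0
  | 5 => 0
  | s + 6 => if (s + 1).Prime then 0 else
      ((aliveMoment s + aliveMoment (s + 1) + aliveMoment (s + 2) + aliveMoment (s + 3)
        + aliveMoment (s + 4) + aliveMoment (s + 5)) +
      (aliveMass s + aliveMass (s + 1) + aliveMass (s + 2) + aliveMass (s + 3) + aliveMass (s + 4)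
        + aliveMass (s + 5))) / 6

theorem aliveMass_add_six (s : ℕ) : aliveMass (s + 6) = if (s + 1).Prime then 0 else
    (aliveMass s + aliveMass (s + 1) + aliveMass (s + 2) + aliveMass (s + 3) + aliveMass (s + 4)
      + aliveMass (s + 5)) / 6 := by
  rw [aliveMass]

theorem aliveMoment_add_six (s : ℕ) : aliveMoment (s + 6) = if (s + 1).Prime then 0 else
    ((aliveMoment s + aliveMoment (s + 1) + aliveMoment (s + 2) + aliveMoment (s + 3)
      + aliveMoment (s + 4) + aliveMoment (s + 5)) +
    (aliveMass s + aliveMass (s + 1) + aliveMass (s + 2) + aliveMass (s + 3) + aliveMass (s + 4)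
      + aliveMass (s + 5))) / 6 := by
  rw [aliveMoment]

/-- The probability that no prime is hit up to the site `s`. -/
noncomputable def crossingMass (s : ℕ) : ℝ :=
  (aliveMass s + 2 * aliveMass (s + 1) + 3 * aliveMass (s + 2) + 4 * aliveMass (s + 3)
    + 5 * aliveMass (s + 4) + 6 * aliveMass (s + 5)) / 6

theorem crossingMass_nonneg (s : ℕ) : 0 ≤ crossingMass s := by
  unfold crossingMass; positivity

/-- Index `s + 6` is the site `s + 1`: reaching it alive requires stepping past `s` without having
hit a prime. -/
theorem aliveMass_le_crossingMass (s : ℕ) : (aliveMass (s + 6) : ℝ) ≤ crossingMass s := by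
  have h := crossingMass_nonneg s
  rw [aliveMass_add_six]
  split_ifs
  · simpa using h
  · have h1 := (aliveMass (s + 1)).2
    have h2 := (aliveMass (s + 2)).2
    have h3 := (aliveMass (s + 3)).2
    have h4 := (aliveMass (s + 4)).2
    have h5 := (aliveMass (s + 5)).2
    simp only [NNReal.val_eq_coe] at h1 h2 h3 h4 h5
    push_cast
    unfold crossingMass
    linarith

theorem crossingMass_succ_of_not_prime {s : ℕ} (hs : ¬ (s + 1).Prime) :
    crossingMass (s + 1) = crossingMass s := by
  have h := aliveMass_add_six s
  rw [if_neg hs] at h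
  unfold crossingMass
  rw [show s + 1 + 5 = s + 6 by ring, h]
  push_cast
  ring_nf

/-- From each of the six sites, a jump past `s` lands exactly on `s + 1` with conditional
probability at least 1/6. Termwise this is `j ≤ 5/6 * (j + 1)` for `j ≤ 5`. -/
theorem crossingMass_succ_of_prime {s : ℕ} (hs : (s + 1).Prime) :
    crossingMass (s + 1) ≤ 5 / 6 * crossingMass s := by
  have h := aliveMass_add_six s
  rw [if_pos hs] at h
  unfold crossingMass
  rw [show s + 1 + 5 = s + 6 by ring, h]
  have h0 := (aliveMass s).2
  have h1 := (aliveMass (s + 1)).2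
  have h2 := (aliveMass (s + 2)).2
  have h3 := (aliveMass (s + 3)).2
  have h4 := (aliveMass (s + 4)).2
  have h5 := (aliveMass (s + 5)).2
  simp only [NNReal.val_eq_coe] at h0 h1 h2 h3 h4 h5
  simp only [show s + 1 + 1 = s + 2 by ring, show s + 1 + 2 = s + 3 by ring,
    show s + 1 + 3 = s + 4 by ring, show s + 1 + 4 = s + 5 by ring]
  push_cast
  linarith

theorem primeCounting_succ (s : ℕ) :
    Nat.primeCounting (s + 1) = Nat.primeCounting s + if (s + 1).Prime then 1 else 0 := by
  simp only [Nat.primeCounting, Nat.primeCounting', Nat.count_succ]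

theorem antitone_crossingMass_mul_pow :
    Antitone fun s => crossingMass s * (6 / 5 : ℝ) ^ Nat.primeCounting s := by
  refine antitone_nat_of_succ_le fun s => ?_
  simp only [primeCounting_succ]
  have hp : (0 : ℝ) < (6 / 5 : ℝ) ^ Nat.primeCounting s := by positivity
  split_ifs with hs
  · have := mul_le_mul_of_nonneg_right (crossingMass_succ_of_prime hs) hp.le
    rw [pow_succ]
    linarith
  · rw [crossingMass_succ_of_not_prime hs, add_zero]

/-- Every roll is at least 1, so a visit to site `s` happens at time at most `s`. The induction
keeps the shift by 5 on the left, which avoids subtraction and covers the empty sites. -/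
theorem aliveMoment_le (s : ℕ) : aliveMoment (s + 5) ≤ s * aliveMass (s + 5) := by
  suffices h : ∀ s, aliveMoment s + 5 * aliveMass s ≤ s * aliveMass s by
    have := h (s + 5)
    push_cast at this
    rw [add_mul] at this
    exact le_of_add_le_add_right this
  intro s
  induction s using Nat.strong_induction_on with
  | _ s ih =>
    match s with
    | 0 => simp [aliveMoment, aliveMass]
    | 1 => simp [aliveMoment, aliveMass]
    | 2 => simp [aliveMoment, aliveMass]
    | 3 => simp [aliveMoment, aliveMass]
    | 4 => simp [aliveMoment, aliveMass]
    | 5 => simp [aliveMoment, aliveMass]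
    | s + 6 =>
      rw [aliveMass_add_six, aliveMoment_add_six]
      split_ifs
      · simp
      have h0 := ih s (by omega)
      have h1 := ih (s + 1) (by omega)
      have h2 := ih (s + 2) (by omega)
      have h3 := ih (s + 3) (by omega)
      have h4 := ih (s + 4) (by omega)
      have h5 := ih (s + 5) (by omega)
      rw [← NNReal.coe_le_coe] at h0 h1 h2 h3 h4 h5 ⊢
      push_cast at h0 h1 h2 h3 h4 h5 ⊢
      have i0 := (aliveMass s).2
      have i1 := (aliveMass (s + 1)).2
      have i2 := (aliveMass (s + 2)).2
      have i3 := (aliveMass (s + 3)).2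
      have i4 := (aliveMass (s + 4)).2
      simp only [NNReal.val_eq_coe] at i0 i1 i2 i3 i4
      linarith

/-! ### Exact evaluation of the recursions -/

/-- Trial division, correct below `37 ^ 2`. -/
def trialPrime (n : ℕ) : Bool :=
  Nat.ble 2 n && [2, 3, 5, 7, 11, 13, 17, 19, 23, 29, 31].all
    fun d => !(Nat.beq (n % d) 0) || Nat.beq n d

theorem trialPrime_iff {n : ℕ} (hn : n < 1369) : trialPrime n = true ↔ n.Prime := by
  simp only [trialPrime, Bool.and_eq_true, Nat.ble_eq, List.all_eq_true, Bool.or_eq_true,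
    Bool.not_eq_true', ← Bool.not_eq_true, Nat.beq_eq]
  constructor
  · rintro ⟨h2, h⟩
    by_contra hp
    have hm : n.minFac.Prime := Nat.minFac_prime (by omega)
    have hsq := Nat.minFac_sq_le_self (by omega : 0 < n) hp
    have hlt : n.minFac < 37 := by nlinarith
    have hd : n % n.minFac = 0 := Nat.mod_eq_zero_of_dvd n.minFac_dvd
    have hne : n ≠ n.minFac := fun e => hp (e ▸ hm)
    have hmem : n.minFac ∈ [2, 3, 5, 7, 11, 13, 17, 19, 23, 29, 31] := by
      generalize n.minFac = q at hm hlt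
      interval_cases q <;> first | decide | (exfalso; revert hm; norm_num)
    rcases h _ hmem with h | h
    · exact h hd
    · exact hne h
  · intro hp
    refine ⟨hp.two_le, fun d hd => or_iff_not_imp_left.2 fun h => ?_⟩
    have hdvd : d ∣ n := Nat.dvd_of_mod_eq_zero (not_not.1 h)
    rcases (Nat.dvd_prime hp).1 hdvd with rfl | e
    · simp at hd
    · exact e.symm

/-- Application of `k` to `n`, arranged so that the kernel first evaluates `n`. -/
def forceNat (n : ℕ) (k : ℕ → Bool) : Bool :=
  Nat.rec (k 0) (fun m _ => k (m + 1)) n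

theorem forceNat_eq (n : ℕ) (k : ℕ → Bool) : forceNat n k = k n := by
  cases n <;> rfl

/-- `fuel` steps of the two recursions on windows of six entries, scaled by powers of `6`, with the
running number of primes `c` and the running sums `a`, `b`. -/
def runWindow (k : ℕ → ℕ → ℕ → ℕ → ℕ → ℕ → ℕ → ℕ → ℕ → Bool) :
    ℕ → ℕ → ℕ → ℕ → ℕ → ℕ → ℕ → ℕ → ℕ → ℕ → ℕ → ℕ → ℕ → ℕ → ℕ → ℕ → ℕ → Bool
  | 0, _, c, x0, x1, x2, x3, x4, x5, _, _, _, _, _, _, a, b => k c x0 x1 x2 x3 x4 x5 a b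
  | n + 1, s, c, x0, x1, x2, x3, x4, x5, y0, y1, y2, y3, y4, y5, a, b =>
    forceNat (s + 1) fun s' =>
    forceNat (bif trialPrime s' then 0 else 1) fun u =>
    forceNat (c + (1 - u)) fun c' =>
    -- The entry of index `t` is stored as `6 ^ (t - 5)` times its value, which is an integer; the
    -- weights `6 ^ 5, …, 6, 1` bring the window to a common scale.
    forceNat (u * (7776 * x0 + 1296 * x1 + 216 * x2 + 36 * x3 + 6 * x4 + x5)) fun x' =>
    -- At a nonprime site the averaged masses in the moment recursion equal the new mass, so adding
    -- `x'` suffices.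
    forceNat (u * (7776 * y0 + 1296 * y1 + 216 * y2 + 36 * y3 + 6 * y4 + y5 + x')) fun y' =>
    forceNat (6 * a + x') fun a' =>
    forceNat (6 * b + y') fun b' =>
    runWindow k n s' c' x1 x2 x3 x4 x5 x' y1 y2 y3 y4 y5 y' a' b'

/-- The numbers carried by `runWindow` are the scaled values at `s`. -/
def WindowSpec (s c x0 x1 x2 x3 x4 x5 y0 y1 y2 y3 y4 y5 a b : ℕ) : Prop :=
  c = Nat.primeCounting s ∧
  (7776 * x0 : ℝ) = 6 ^ s * aliveMass s ∧ (1296 * x1 : ℝ) = 6 ^ s * aliveMass (s + 1) ∧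
  (216 * x2 : ℝ) = 6 ^ s * aliveMass (s + 2) ∧ (36 * x3 : ℝ) = 6 ^ s * aliveMass (s + 3) ∧
  (6 * x4 : ℝ) = 6 ^ s * aliveMass (s + 4) ∧ (x5 : ℝ) = 6 ^ s * aliveMass (s + 5) ∧
  (7776 * y0 : ℝ) = 6 ^ s * aliveMoment s ∧ (1296 * y1 : ℝ) = 6 ^ s * aliveMoment (s + 1) ∧
  (216 * y2 : ℝ) = 6 ^ s * aliveMoment (s + 2) ∧ (36 * y3 : ℝ) = 6 ^ s * aliveMoment (s + 3) ∧
  (6 * y4 : ℝ) = 6 ^ s * aliveMoment (s + 4) ∧ (y5 : ℝ) = 6 ^ s * aliveMoment (s + 5) ∧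
  (a : ℝ) = 6 ^ s * ∑ t ∈ Finset.range (s + 6), (aliveMass t : ℝ) ∧
  (b : ℝ) = 6 ^ s * ∑ t ∈ Finset.range (s + 6), (aliveMoment t : ℝ)

theorem windowSpec_zero : WindowSpec 0 0 0 0 0 0 0 1 0 0 0 0 0 0 1 0 := by
  simp [WindowSpec, aliveMass, aliveMoment, Finset.sum_range_succ]

theorem WindowSpec.succ {s c x0 x1 x2 x3 x4 x5 y0 y1 y2 y3 y4 y5 a b : ℕ} (hs : s + 1 < 1369)
    (h : WindowSpec s c x0 x1 x2 x3 x4 x5 y0 y1 y2 y3 y4 y5 a b) {u c' x' y' : ℕ}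
    (hu : u = bif trialPrime (s + 1) then 0 else 1) (hc : c' = c + (1 - u))
    (hx : x' = u * (7776 * x0 + 1296 * x1 + 216 * x2 + 36 * x3 + 6 * x4 + x5))
    (hy : y' = u * (7776 * y0 + 1296 * y1 + 216 * y2 + 36 * y3 + 6 * y4 + y5 + x')) :
    WindowSpec (s + 1) c' x1 x2 x3 x4 x5 x' y1 y2 y3 y4 y5 y' (6 * a + x') (6 * b + y') := by
  obtain ⟨rfl, h0, h1, h2, h3, h4, h5, k0, k1, k2, k3, k4, k5, ha, hb⟩ := h
  have hx' : (x' : ℝ) = 6 ^ (s + 1) * aliveMass (s + 6) := by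
    rw [aliveMass_add_six, hx, hu]
    by_cases hp : (s + 1).Prime
    · simp [(trialPrime_iff hs).2 hp, hp]
    · simp only [hp, mt (trialPrime_iff hs).1 hp, cond_false, if_false, one_mul]
      push_cast
      rw [pow_succ, h0, h1, h2, h3, h4, h5]
      ring
  have hy' : (y' : ℝ) = 6 ^ (s + 1) * aliveMoment (s + 6) := by
    rw [aliveMoment_add_six, hy, hu]
    by_cases hp : (s + 1).Prime
    · simp [(trialPrime_iff hs).2 hp, hp]
    · rw [aliveMass_add_six] at hx'
      simp only [hp, mt (trialPrime_iff hs).1 hp, cond_false, if_false, one_mul] at hx' ⊢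
      push_cast at hx' ⊢
      rw [hx', pow_succ, k0, k1, k2, k3, k4, k5]
      ring
  refine ⟨?_, ?_, ?_, ?_, ?_, ?_, hx', ?_, ?_, ?_, ?_, ?_, hy', ?_, ?_⟩
  · rw [hc, hu, primeCounting_succ]
    by_cases hp : (s + 1).Prime
    · simp [(trialPrime_iff hs).2 hp, hp]
    · simp [mt (trialPrime_iff hs).1 hp, hp]
  · rw [pow_succ]; linarith
  · rw [pow_succ]; linarith
  · rw [pow_succ]; linarith
  · rw [pow_succ]; linarith
  · rw [pow_succ]; linarith
  · rw [pow_succ]; linarith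
  · rw [pow_succ]; linarith
  · rw [pow_succ]; linarith
  · rw [pow_succ]; linarith
  · rw [pow_succ]; linarith
  · rw [show s + 1 + 6 = s + 6 + 1 by ring, Finset.sum_range_succ, mul_add, ← hx', pow_succ]
    push_cast
    linarith
  · rw [show s + 1 + 6 = s + 6 + 1 by ring, Finset.sum_range_succ, mul_add, ← hy', pow_succ]
    push_cast
    linarith

theorem runWindow_spec (k : ℕ → ℕ → ℕ → ℕ → ℕ → ℕ → ℕ → ℕ → ℕ → Bool) (n : ℕ) :
    ∀ {s c x0 x1 x2 x3 x4 x5 y0 y1 y2 y3 y4 y5 a b : ℕ}, s + n < 1369 →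
    WindowSpec s c x0 x1 x2 x3 x4 x5 y0 y1 y2 y3 y4 y5 a b →
    runWindow k n s c x0 x1 x2 x3 x4 x5 y0 y1 y2 y3 y4 y5 a b = true →
    ∃ c x0 x1 x2 x3 x4 x5 y0 y1 y2 y3 y4 y5 a b,
      WindowSpec (s + n) c x0 x1 x2 x3 x4 x5 y0 y1 y2 y3 y4 y5 a b ∧
      k c x0 x1 x2 x3 x4 x5 a b = true := by
  induction n with
  | zero => exact fun _ h hk => ⟨_, _, _, _, _, _, _, _, _, _, _, _, _, _, _, h,
      by simpa only [runWindow] using hk⟩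
  | succ n ih =>
    intro s c x0 x1 x2 x3 x4 x5 y0 y1 y2 y3 y4 y5 a b hs h hk
    rw [show s + (n + 1) = s + 1 + n by ring]
    simp only [runWindow, forceNat_eq] at hk
    exact ih (by omega) (h.succ (by omega) rfl rfl rfl rfl) hk

/-- The numerical conditions that are checked at `s = 1024`. -/
def windowCheck (c x0 x1 x2 x3 x4 x5 a b : ℕ) : Bool :=
  Nat.ble c 172 &&
  Nat.ble (10 ^ 24 * (7776 * x0 + 2 * (1296 * x1) + 3 * (216 * x2) + 4 * (36 * x3) + 5 * (6 * x4)
    + 6 * x5)) (6 * 6 ^ 1024) &&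
  Nat.ble (2428497912693504 * 6 ^ 1024) (10 ^ 15 * a) &&
  Nat.ble (10 ^ 15 * a) (2428497914693504 * 6 ^ 1024) &&
  Nat.ble (12140380784092779 * 6 ^ 1024) (10 ^ 15 * (2 * b + a)) &&
  Nat.ble (10 ^ 15 * (2 * b + a)) (12140380786092779 * 6 ^ 1024)

theorem runWindow_check :
    runWindow windowCheck 1024 0 0 0 0 0 0 0 1 0 0 0 0 0 0 1 0 = true := by
  decide +kernel

theorem evaluation_bounds :
    Nat.primeCounting 1024 ≤ 172 ∧ crossingMass 1024 ≤ 1 / 10 ^ 24 ∧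
    |∑ t ∈ Finset.range 1030, (aliveMass t : ℝ) - 2.428497913693504| ≤ 1 / 10 ^ 9 ∧
    |∑ t ∈ Finset.range 1030, (2 * aliveMoment t + aliveMass t : ℝ) - 12.140380785092779|
      ≤ 1 / 10 ^ 9 := by
  obtain ⟨c, x0, x1, x2, x3, x4, x5, y0, y1, y2, y3, y4, y5, a, b, hw, hk⟩ :=
    runWindow_spec windowCheck 1024 (by norm_num) windowSpec_zero runWindow_check
  rw [zero_add] at hw
  obtain ⟨hπ, h0, h1, h2, h3, h4, h5, -, -, -, -, -, -, ha, hb⟩ := hw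
  simp only [windowCheck, Bool.and_eq_true, Nat.ble_eq] at hk
  obtain ⟨⟨⟨⟨⟨hc, hq⟩, ha1⟩, ha2⟩, hb1⟩, hb2⟩ := hk
  rw [← Nat.cast_le (α := ℝ)] at hq ha1 ha2 hb1 hb2
  simp only [Nat.cast_mul, Nat.cast_add, Nat.cast_pow, Nat.cast_ofNat] at hq ha1 ha2 hb1 hb2
  rw [h0, h1, h2, h3, h4, h5] at hq
  have hpos : (0 : ℝ) < 6 ^ 1024 := by positivity
  rw [ha] at ha1 ha2
  rw [ha, hb] at hb1 hb2
  rw [Finset.sum_add_distrib, ← Finset.mul_sum]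
  simp only [Nat.reduceAdd] at ha1 ha2 hb1 hb2 hq ⊢
  unfold crossingMass
  generalize (6 : ℝ) ^ 1024 = D at ha1 ha2 hb1 hb2 hq hpos
  generalize ∑ t ∈ Finset.range 1030, (aliveMass t : ℝ) = A at ha1 ha2 hb1 hb2 ⊢
  generalize ∑ t ∈ Finset.range 1030, (aliveMoment t : ℝ) = B at hb1 hb2 ⊢
  have key : ∀ {u v : ℝ}, D * u ≤ D * v → u ≤ v := fun h => le_of_mul_le_mul_left h hpos
  refine ⟨hπ ▸ hc, ?_, ?_, ?_⟩
  · refine key ?_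
    linarith
  · rw [abs_le]
    constructor <;> refine key ?_ <;> linarith
  · rw [abs_le]
    constructor <;> refine key ?_ <;> linarith

/-! ### Tail estimates -/

/-- Compares a lower bound for Chebyshev's `ψ` at `2 ^ m` with `ψ(N) ≤ π(N) log N`, then divides by
`log 2`. -/
theorem two_pow_le_mul_primeCounting (m : ℕ) :
    2 ^ m ≤ m * Nat.primeCounting (2 ^ m) + m + 1 := by
  have h1 := Chebyshev.psi_ge (2 ^ m)
  have h2 := Chebyshev.psi_le_primeCounting_mul_log (2 ^ m)
  have hlog : Real.log (((2 ^ m : ℕ) : ℝ) + 1) ≤ (m + 1) * Real.log 2 := by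
    have : ((2 ^ m : ℕ) : ℝ) + 1 ≤ 2 ^ (m + 1) := by
      have := one_le_pow₀ (M₀ := ℝ) one_le_two (n := m)
      rw [pow_succ]; push_cast; linarith
    calc _ ≤ Real.log (2 ^ (m + 1)) := Real.log_le_log (by positivity) this
      _ = _ := by rw [Real.log_pow]; push_cast; ring
  have h2' : Real.log ((2 ^ m : ℕ) : ℝ) = m * Real.log 2 := by
    push_cast; rw [Real.log_pow]
  rw [h2'] at h2
  have hl : 0 < Real.log 2 := Real.log_pos one_lt_two
  have h : ((2 ^ m : ℕ) : ℝ) * Real.log 2 ≤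
      (m * Nat.primeCounting (2 ^ m) + m + 1) * Real.log 2 := by linarith
  exact_mod_cast le_of_mul_le_mul_right h hl

/-- Slope 16 is what the decay estimate needs: `(6/5) ^ 16 ≥ 16 = 2 ^ 4`, so each doubling of `s`
gains at least the factor by which `s ^ 4` grows. -/
theorem primeCounting_two_pow_ge {m : ℕ} (hm : 10 ≤ m) :
    16 * m ≤ Nat.primeCounting (2 ^ m) + 59 := by
  have hpow : ∀ d : ℕ, (d + 10) * (16 * (d + 10)) + 2 ≤ 2 ^ (d + 10) + 59 * (d + 10) := by
    intro d
    induction d with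
    | zero => norm_num
    | succ d ih => rw [show d + 1 + 10 = d + 10 + 1 by ring, pow_succ]; nlinarith
  obtain ⟨d, rfl⟩ := Nat.exists_eq_add_of_le' hm
  by_contra! h
  have h1 := two_pow_le_mul_primeCounting (d + 10)
  have h2 := hpow d
  have h3 : (d + 10) * (Nat.primeCounting (2 ^ (d + 10)) + 59 + 1) ≤ (d + 10) * (16 * (d + 10)) :=
    Nat.mul_le_mul_left _ h
  nlinarith

theorem crossingMass_mul_pow_le {s : ℕ} (hs : 1024 ≤ s) :
    crossingMass s * (s + 1) ^ 4 ≤ 1 / 10 ^ 5 := by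
  have hlog : 10 ≤ Nat.log 2 s := Nat.le_log_of_pow_le one_lt_two (by simpa using hs)
  obtain ⟨d, hd⟩ := Nat.exists_eq_add_of_le hlog
  have hlow : 2 ^ (10 + d) ≤ s := hd ▸ Nat.pow_log_le_self 2 (by omega)
  have hup : s < 2 ^ (10 + d + 1) := hd ▸ Nat.lt_pow_succ_log_self one_lt_two s
  have hπ : 101 + 16 * d ≤ Nat.primeCounting s := by
    have := primeCounting_two_pow_ge (m := 10 + d) (by omega)
    have := Nat.monotone_primeCounting hlow
    omega
  obtain ⟨hc, hq, -⟩ := evaluation_bounds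
  have hanti := antitone_crossingMass_mul_pow hs
  simp only at hanti
  -- Monotonicity from 1024 to `s`, with `π(1024) ≤ 172` and `π(s) ≥ 101 + 16 d`; the surplus `(6/5)
  -- ^ 71` is absorbed by `10 ^ (-24)`.
  have h1 : crossingMass s * ((6 / 5) ^ 101 * 16 ^ d) ≤ 1 / 10 ^ 24 * (6 / 5) ^ 172 := by
    refine le_trans ?_ (hanti.trans ?_)
    · refine mul_le_mul_of_nonneg_left ?_ (crossingMass_nonneg s)
      calc (6 / 5 : ℝ) ^ 101 * 16 ^ d ≤ (6 / 5) ^ 101 * ((6 / 5) ^ 16) ^ d := by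
            gcongr; norm_num
        _ = (6 / 5) ^ (101 + 16 * d) := by rw [pow_add, pow_mul]
        _ ≤ _ := pow_le_pow_right₀ (by norm_num) hπ
    · exact mul_le_mul hq (pow_le_pow_right₀ (by norm_num) hc) (by positivity) (by positivity)
  have h2 : ((s : ℝ) + 1) ^ 4 ≤ 2 ^ 44 * 16 ^ d := by
    have : (s : ℝ) + 1 ≤ 2 ^ (10 + d + 1) := by exact_mod_cast hup
    calc ((s : ℝ) + 1) ^ 4 ≤ (2 ^ (10 + d + 1)) ^ 4 := by gcongr
      _ = 2 ^ 44 * (2 ^ 4) ^ d := by rw [← pow_mul, ← pow_mul, ← pow_add]; congr 1; ring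
      _ = _ := by norm_num
  have h3 : crossingMass s * 16 ^ d ≤ 1 / 10 ^ 24 * (6 / 5) ^ 71 := by
    have : (6 / 5 : ℝ) ^ 172 = (6 / 5) ^ 71 * (6 / 5) ^ 101 := by rw [← pow_add]
    rw [this] at h1
    refine le_of_mul_le_mul_right (a := (6 / 5 : ℝ) ^ 101) ?_ (by positivity)
    linarith
  calc crossingMass s * (s + 1) ^ 4 ≤ crossingMass s * (2 ^ 44 * 16 ^ d) :=
        mul_le_mul_of_nonneg_left h2 (crossingMass_nonneg s)
    _ = 2 ^ 44 * (crossingMass s * 16 ^ d) := by ring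
    _ ≤ 2 ^ 44 * (1 / 10 ^ 24 * (6 / 5) ^ 71) := by gcongr
    _ ≤ _ := by norm_num

/-- The fourth-power decay leaves a summable remainder, put in telescoping form; the full sum is at
most `10 ^ (-5) / 1024 < 10 ^ (-8)`. -/
theorem crossingMass_mul_le (s : ℕ) :
    (2 * (s + 1024) + 3) * crossingMass (s + 1024) ≤
      1 / 10 ^ 5 * (1 / ((s : ℝ) + 1024) - 1 / ((s : ℝ) + 1 + 1024)) := by
  have h := crossingMass_mul_pow_le (s := s + 1024) (by omega)
  push_cast at h
  have hs : (0 : ℝ) ≤ s := s.cast_nonneg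
  generalize (s : ℝ) = x at h hs
  have hQ := crossingMass_nonneg (s + 1024)
  generalize crossingMass (s + 1024) = Q at h hQ
  rw [show 1 / (x + 1024) - 1 / (x + 1 + 1024) = 1 / ((x + 1024) * (x + 1025)) by
    field_simp; ring, mul_one_div, le_div_iff₀ (by positivity)]
  refine le_trans ?_ h
  rw [show (2 * (x + 1024) + 3) * Q * ((x + 1024) * (x + 1025))
    = Q * ((2 * (x + 1024) + 3) * ((x + 1024) * (x + 1025))) by ring]
  refine mul_le_mul_of_nonneg_left ?_ hQ
  calc (2 * (x + 1024) + 3) * ((x + 1024) * (x + 1025))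
      ≤ ((x + 1025) * (x + 1025)) * ((x + 1025) * (x + 1025)) := by
        gcongr
        · nlinarith
        · linarith
    _ = _ := by ring

theorem summable_and_tsum_sub_le {f : ℕ → ℝ} (hf : ∀ s, 0 ≤ f s)
    (h : ∀ s, f (s + 1030) ≤ 1 / 10 ^ 5 * (1 / ((s : ℝ) + 1024) - 1 / ((s : ℝ) + 1 + 1024))) :
    Summable f ∧ |∑' s, f s - ∑ s ∈ Finset.range 1030, f s| ≤ 1 / 10 ^ 8 := by
  have hb : ∀ n, ∑ s ∈ Finset.range n, f (s + 1030) ≤ 1 / 10 ^ 8 := by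
    intro n
    calc _ ≤ ∑ s ∈ Finset.range n,
          1 / 10 ^ 5 * (1 / ((s : ℝ) + 1024) - 1 / (((s + 1 : ℕ) : ℝ) + 1024)) :=
          Finset.sum_le_sum fun s _ => by simpa using h s
      _ = 1 / 10 ^ 5 * (1 / (((0 : ℕ) : ℝ) + 1024) - 1 / ((n : ℝ) + 1024)) := by
          rw [← Finset.mul_sum, Finset.sum_range_sub' fun s : ℕ => 1 / ((s : ℝ) + 1024)]
      _ ≤ 1 / 10 ^ 5 * (1 / (((0 : ℕ) : ℝ) + 1024)) := by
          gcongr; exact sub_le_self _ (by positivity)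
      _ ≤ _ := by norm_num
  have hs : Summable f :=
    (summable_nat_add_iff 1030).1 (summable_of_sum_range_le (fun s => hf _) hb)
  refine ⟨hs, ?_⟩
  rw [← hs.sum_add_tsum_nat_add 1030, add_sub_cancel_left,
    abs_of_nonneg (tsum_nonneg fun s => hf _)]
  exact Real.tsum_le_of_sum_range_le (fun s => hf _) hb

theorem aliveMass_tail_le (s : ℕ) :
    2 * (aliveMoment (s + 1030) : ℝ) + aliveMass (s + 1030) ≤
      1 / 10 ^ 5 * (1 / ((s : ℝ) + 1024) - 1 / ((s : ℝ) + 1 + 1024)) := by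
  have h1 : (aliveMoment (s + 1025 + 5) : ℝ) ≤ (s + 1025 : ℕ) * aliveMass (s + 1025 + 5) :=
    mod_cast aliveMoment_le (s + 1025)
  push_cast at h1
  have h2 := aliveMass_le_crossingMass (s + 1024)
  have h4 : (2 * (s + 1024) + 3 : ℝ) * aliveMass (s + 1030) ≤
    (2 * (s + 1024) + 3) * crossingMass (s + 1024) := by gcongr
  refine le_trans ?_ (h4.trans (crossingMass_mul_le s))
  linarith

theorem tsum_aliveMass_bounds : Summable aliveMass ∧
    |∑' t, (aliveMass t : ℝ) - 2.428497913693504| ≤ 2 / 10 ^ 8 := by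
  obtain ⟨h1, h2⟩ := summable_and_tsum_sub_le (f := fun s => (aliveMass s : ℝ))
    (fun s => (aliveMass s).2) fun s => le_trans (by simp) (aliveMass_tail_le s)
  refine ⟨NNReal.summable_coe.1 h1, ?_⟩
  have h3 := evaluation_bounds.2.2.1
  rw [abs_le] at *
  constructor <;> linarith

theorem tsum_two_mul_aliveMoment_add_bounds :
    Summable (fun t => 2 * aliveMoment t + aliveMass t) ∧
    |∑' t, (2 * aliveMoment t + aliveMass t : ℝ) - 12.140380785092779| ≤ 2 / 10 ^ 8 := by
  obtain ⟨h1, h2⟩ := summable_and_tsum_sub_le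
    (f := fun s => (2 * aliveMoment s + aliveMass s : ℝ)) (fun s => by positivity) aliveMass_tail_le
  refine ⟨NNReal.summable_coe.1 (mod_cast h1), ?_⟩
  have h3 := evaluation_bounds.2.2.2
  rw [abs_le] at *
  constructor <;> linarith

/-! ### The walk -/

section Walk

variable {Ω : Type*} {X : ℕ → Ω → ℕ}

/-- No prime among `S_0, …, S_n`. -/
def noPrime (X : ℕ → Ω → ℕ) (n : ℕ) : Set Ω :=
  {ω | ∀ k ≤ n, ¬ (rollSum X k ω).Prime}

/-- No prime among `S_0, …, S_n`, and `S_n + 5 = s`. -/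
def aliveAt (X : ℕ → Ω → ℕ) (n s : ℕ) : Set Ω :=
  noPrime X n ∩ {ω | rollSum X n ω + 5 = s}

theorem rollSum_zero (ω : Ω) : rollSum X 0 ω = 0 := by simp [rollSum]

theorem rollSum_succ (n : ℕ) (ω : Ω) : rollSum X (n + 1) ω = rollSum X n ω + X n ω := by
  simp [rollSum, Finset.sum_range_succ]

theorem mem_noPrime_succ {n : ℕ} {ω : Ω} :
    ω ∈ noPrime X (n + 1) ↔ ω ∈ noPrime X n ∧ ¬ (rollSum X (n + 1) ω).Prime := by
  simp only [noPrime, Set.mem_ofPred_eq]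
  constructor
  · exact fun h => ⟨fun k hk => h k (by omega), h _ le_rfl⟩
  · rintro ⟨h1, h2⟩ k hk
    rcases Nat.le_succ_iff.1 hk with h | rfl
    · exact h1 k h
    · exact h2

theorem noPrime_zero : noPrime X 0 = Set.univ := by
  ext ω
  simp [noPrime, rollSum_zero, Nat.not_prime_zero]

theorem aliveAt_of_lt {n s : ℕ} (hs : s < 5) : aliveAt X n s = ∅ := by
  ext ω
  simp only [aliveAt, Set.mem_inter_iff, Set.mem_ofPred_eq, Set.mem_empty_iff_false, iff_false]
  omega

theorem aliveAt_zero_five : aliveAt X 0 5 = Set.univ := by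
  ext ω
  simp [aliveAt, noPrime_zero, rollSum_zero]

theorem aliveAt_zero_add_six (s : ℕ) : aliveAt X 0 (s + 6) = ∅ := by
  ext ω
  simp only [aliveAt, Set.mem_inter_iff, Set.mem_ofPred_eq, Set.mem_empty_iff_false, iff_false,
    rollSum_zero]
  omega

theorem aliveAt_succ_of_prime {n s : ℕ} (hs : (s + 1).Prime) : aliveAt X (n + 1) (s + 6) = ∅ := by
  ext ω
  simp only [aliveAt, Set.mem_inter_iff, mem_noPrime_succ, Set.mem_ofPred_eq,
    Set.mem_empty_iff_false, iff_false]
  rintro ⟨⟨-, h⟩, h'⟩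
  exact h ((by omega : rollSum X (n + 1) ω = s + 1) ▸ hs)

theorem mem_aliveAt_succ {n s : ℕ} (hs : ¬ (s + 1).Prime) {ω : Ω} (hω : X n ω ∈ Set.Icc 1 6) :
    ω ∈ aliveAt X (n + 1) (s + 6) ↔
      ω ∈ ⋃ j ∈ Finset.range 6, aliveAt X n (s + j) ∩ X n ⁻¹' {6 - j} := by
  obtain ⟨h1, h6⟩ := hω
  simp only [Set.mem_iUnion, Finset.mem_range, exists_prop, aliveAt, Set.mem_inter_iff,
    mem_noPrime_succ, Set.mem_ofPred_eq, rollSum_succ, Set.mem_preimage, Set.mem_singleton_iff]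
  constructor
  · rintro ⟨⟨h, -⟩, h'⟩
    exact ⟨6 - X n ω, by omega, ⟨h, by omega⟩, by omega⟩
  · rintro ⟨j, hj, ⟨h, h'⟩, hX⟩
    refine ⟨⟨h, ?_⟩, by omega⟩
    rwa [show rollSum X n ω + X n ω = s + 1 by omega]

theorem noPrime_eq_iUnion_aliveAt (n : ℕ) : noPrime X n = ⋃ s, aliveAt X n s := by
  ext ω
  simp [aliveAt]

theorem mem_noPrime_iff_lt_primeHit {n : ℕ} {ω : Ω} :
    ω ∈ noPrime X n ↔ (n : ℕ∞) < primeHit X ω := by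
  rw [← not_iff_not, not_lt]
  have : primeHit X ω ≤ (n : ℕ∞) ↔ ∃ j ∈ Set.Icc 1 n, rollSum X j ω ∈ {p : ℕ | p.Prime} :=
    hittingAfter_le_iff
  rw [this]
  simp only [noPrime, Set.mem_ofPred_eq, not_forall, not_not, Set.mem_Icc, exists_prop]
  constructor
  · rintro ⟨k, hk, hp⟩
    -- `noPrime` also tests `k = 0`, which `primeHit` skips; this is harmless because `S_0 = 0` is
    -- not prime.
    refine ⟨k, ⟨Nat.one_le_iff_ne_zero.2 ?_, hk⟩, hp⟩
    rintro rfl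
    rw [rollSum_zero] at hp
    exact Nat.not_prime_zero hp
  · rintro ⟨k, ⟨-, hk⟩, hp⟩
    exact ⟨k, hk, hp⟩

/-- Used with `c n = 1`, giving `τ`, and with `c n = 2 n + 1`, giving `τ ^ 2`. -/
theorem tsum_indicator_noPrime (c : ℕ → ℝ≥0∞) {ω : Ω} (hω : primeHit X ω ≠ ⊤) :
    ∑' n, c n * (noPrime X n).indicator 1 ω =
      ∑ n ∈ Finset.range (primeHit X ω).toNat, c n := by
  have hiff : ∀ n, ω ∈ noPrime X n ↔ n ∈ Finset.range (primeHit X ω).toNat := fun n => by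
    rw [mem_noPrime_iff_lt_primeHit, Finset.mem_range, ← ENat.natCast_lt_natCast,
      ENat.natCast_toNat hω]
  rw [tsum_eq_sum (s := Finset.range (primeHit X ω).toNat) fun n hn => by
    rw [Set.indicator_of_notMem (mt (hiff n).1 hn), mul_zero]]
  refine Finset.sum_congr rfl fun n hn => ?_
  rw [Set.indicator_of_mem ((hiff n).2 hn), Pi.one_apply, mul_one]

theorem sum_range_two_mul_add_one (m : ℕ) :
    ∑ n ∈ Finset.range m, (2 * (n : ℝ≥0∞) + 1) = (m : ℝ≥0∞) ^ 2 := by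
  induction m with
  | zero => simp
  | succ m ih => rw [Finset.sum_range_succ, ih]; push_cast; ring

/-! ### Probabilities of the walk's events -/

variable [MeasurableSpace Ω] {μ : Measure Ω}

theorem measurable_rollSum (hmeas : ∀ i, Measurable (X i)) (n : ℕ) : Measurable (rollSum X n) := by
  unfold rollSum
  fun_prop

theorem measurableSet_noPrime (hmeas : ∀ i, Measurable (X i)) (n : ℕ) :
    MeasurableSet (noPrime X n) := by
  have : noPrime X n = ⋂ k ∈ Set.Iic n, rollSum X k ⁻¹' {p | ¬ p.Prime} := by
    ext ω; simp [noPrime]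
  rw [this]
  exact MeasurableSet.biInter (Set.to_countable _) fun k _ =>
    measurable_rollSum hmeas k (MeasurableSet.of_discrete)

theorem measurableSet_aliveAt (hmeas : ∀ i, Measurable (X i)) (n s : ℕ) :
    MeasurableSet (aliveAt X n s) :=
  (measurableSet_noPrime hmeas n).inter
    (measurable_rollSum hmeas n (MeasurableSet.of_discrete (s := {m | m + 5 = s})))

theorem measure_aliveAt_inter (hmeas : ∀ i, Measurable (X i)) (hindep : iIndepFun X μ)
    (n s k : ℕ) :
    μ (aliveAt X n s ∩ X n ⁻¹' {k}) = μ (aliveAt X n s) * μ (X n ⁻¹' {k}) := by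
  have hind := hindep.indepFun_finset (Finset.range n) {n} (by simp) hmeas
  let f : Ω → (Finset.range n → ℕ) := fun ω i => X i ω
  -- The event depends only on the first `n` rolls, hence is independent of `X n`.
  have hpre : aliveAt X n s = f ⁻¹' (f '' aliveAt X n s) := by
    refine (Set.subset_preimage_image _ _).antisymm ?_
    rintro ω ⟨ω', hω', he⟩
    have hX : ∀ i < n, X i ω' = X i ω := fun i hi =>
      congrFun he ⟨i, Finset.mem_range.2 hi⟩
    have hS : ∀ m ≤ n, rollSum X m ω' = rollSum X m ω := fun m hm =>
      Finset.sum_congr rfl fun i hi => hX i ((Finset.mem_range.1 hi).trans_le hm)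
    refine ⟨fun m hm => ?_, ?_⟩
    · rw [← hS m hm]; exact hω'.1 m hm
    · change rollSum X n ω + 5 = s
      rw [← hS n le_rfl]; exact hω'.2
  have hpre' : X n ⁻¹' {k} =
      (fun ω (i : ({n} : Finset ℕ)) => X i ω) ⁻¹' {v | v ⟨n, by simp⟩ = k} := rfl
  rw [hpre, hpre']
  exact hind.measure_inter_preimage_eq_mul _ _ (Set.to_countable _).measurableSet
    (Set.to_countable _).measurableSet

theorem measure_preimage_singleton (hmeas : ∀ i, Measurable (X i))
    (hunif : ∀ i, μ.map (X i) = uniformOn (Set.Icc 1 6)) (n : ℕ) {k : ℕ} (hk : k ∈ Set.Icc 1 6) :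
    μ (X n ⁻¹' {k}) = 6⁻¹ := by
  rw [← Measure.map_apply (hmeas n) (MeasurableSet.singleton k), hunif, uniformOn,
    cond_apply measurableSet_Icc, Set.inter_eq_self_of_subset_right (Set.singleton_subset_iff.2 hk),
    Measure.count_singleton, mul_one, ← Finset.coe_Icc, Measure.count_apply_finset]
  simp

theorem ae_mem_Icc (hmeas : ∀ i, Measurable (X i))
    (hunif : ∀ i, μ.map (X i) = uniformOn (Set.Icc 1 6)) (n : ℕ) :
    ∀ᵐ ω ∂μ, X n ω ∈ Set.Icc 1 6 := by
  refine ae_of_ae_map (hmeas n).aemeasurable (p := fun m => m ∈ Set.Icc 1 6) ?_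
  rw [hunif, uniformOn]
  exact ae_cond_mem measurableSet_Icc

theorem measure_aliveAt_succ (hmeas : ∀ i, Measurable (X i)) (hindep : iIndepFun X μ)
    (hunif : ∀ i, μ.map (X i) = uniformOn (Set.Icc 1 6)) (n s : ℕ) :
    μ (aliveAt X (n + 1) (s + 6)) = if (s + 1).Prime then 0 else
      (μ (aliveAt X n s) + μ (aliveAt X n (s + 1)) + μ (aliveAt X n (s + 2))
        + μ (aliveAt X n (s + 3)) + μ (aliveAt X n (s + 4)) + μ (aliveAt X n (s + 5))) / 6 := by
  split_ifs with hs
  · rw [aliveAt_succ_of_prime hs, measure_empty]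
  -- Decomposition by the last roll; it holds only almost everywhere because a roll may leave `1, …,
  -- 6` on a null set.
  have hae : aliveAt X (n + 1) (s + 6) =ᵐ[μ]
      (⋃ j ∈ Finset.range 6, aliveAt X n (s + j) ∩ X n ⁻¹' {6 - j} : Set Ω) := by
    filter_upwards [ae_mem_Icc hmeas hunif n] with ω hω
    exact propext (mem_aliveAt_succ hs hω)
  rw [measure_congr hae, measure_biUnion_finset]
  · rw [Finset.sum_congr rfl fun j hj => show _ = μ (aliveAt X n (s + j)) * 6⁻¹ by
      rw [measure_aliveAt_inter hmeas hindep, measure_preimage_singleton hmeas hunif]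
      have := Finset.mem_range.1 hj
      constructor <;> omega]
    rw [← Finset.sum_mul, ← div_eq_mul_inv]
    simp [Finset.sum_range_succ]
  · intro i hi j hj hij
    refine Set.disjoint_left.2 fun ω h1 h2 => hij ?_
    have e1 : X n ω = 6 - i := h1.2
    have e2 : X n ω = 6 - j := h2.2
    simp only [Finset.coe_range, Set.mem_Iio] at hi hj
    omega
  · exact fun j _ => (measurableSet_aliveAt hmeas n _).inter (hmeas n (MeasurableSet.singleton _))

theorem measure_aliveAt_succ_five (hmeas : ∀ i, Measurable (X i))
    (hunif : ∀ i, μ.map (X i) = uniformOn (Set.Icc 1 6)) (n : ℕ) :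
    μ (aliveAt X (n + 1) 5) = 0 := by
  refine measure_mono_null ?_ (ae_iff.1 (ae_mem_Icc hmeas hunif n))
  rintro ω ⟨-, h⟩ h'
  simp only [Set.mem_ofPred_eq, rollSum_succ] at h
  have := h'.1
  omega

theorem tsum_measure_aliveAt [IsProbabilityMeasure μ]
    (hmeas : ∀ i, Measurable (X i)) (hindep : iIndepFun X μ)
    (hunif : ∀ i, μ.map (X i) = uniformOn (Set.Icc 1 6)) (s : ℕ) :
    ∑' n, μ (aliveAt X n s) = aliveMass s := by
  induction s using Nat.strong_induction_on with
  | _ s ih =>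
    match s with
    | 0 => simp [aliveAt_of_lt, aliveMass]
    | 1 => simp [aliveAt_of_lt, aliveMass]
    | 2 => simp [aliveAt_of_lt, aliveMass]
    | 3 => simp [aliveAt_of_lt, aliveMass]
    | 4 => simp [aliveAt_of_lt, aliveMass]
    | 5 =>
      rw [tsum_eq_zero_add' ENNReal.summable]
      simp [measure_aliveAt_succ_five hmeas hunif, aliveMass, aliveAt_zero_five]
    | s + 6 =>
      rw [tsum_eq_zero_add' ENNReal.summable, aliveAt_zero_add_six, measure_empty, zero_add,
        aliveMass_add_six]
      simp_rw [measure_aliveAt_succ hmeas hindep hunif]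
      split_ifs
      · simp
      rw [ENNReal.coe_div (by norm_num)]
      push_cast
      simp_rw [div_eq_mul_inv]
      rw [ENNReal.tsum_mul_right]
      simp_rw [ENNReal.tsum_add]
      rw [ih s (by omega), ih (s + 1) (by omega), ih (s + 2) (by omega), ih (s + 3) (by omega),
        ih (s + 4) (by omega), ih (s + 5) (by omega)]

/-- As for the masses, but the shift `n ↦ n + 1` produces a weight `n + 1`, whose `1` contributes
the mass terms. -/
theorem tsum_mul_measure_aliveAt [IsProbabilityMeasure μ]
    (hmeas : ∀ i, Measurable (X i)) (hindep : iIndepFun X μ)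
    (hunif : ∀ i, μ.map (X i) = uniformOn (Set.Icc 1 6)) (s : ℕ) :
    ∑' n : ℕ, n * μ (aliveAt X n s) = aliveMoment s := by
  induction s using Nat.strong_induction_on with
  | _ s ih =>
    match s with
    | 0 => simp [aliveAt_of_lt, aliveMoment]
    | 1 => simp [aliveAt_of_lt, aliveMoment]
    | 2 => simp [aliveAt_of_lt, aliveMoment]
    | 3 => simp [aliveAt_of_lt, aliveMoment]
    | 4 => simp [aliveAt_of_lt, aliveMoment]
    | 5 =>
      rw [tsum_eq_zero_add' ENNReal.summable]
      simp [measure_aliveAt_succ_five hmeas hunif, aliveMoment]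
    | s + 6 =>
      rw [tsum_eq_zero_add' ENNReal.summable, aliveAt_zero_add_six, measure_empty, mul_zero,
        zero_add, aliveMoment_add_six]
      simp_rw [measure_aliveAt_succ hmeas hindep hunif]
      split_ifs
      · simp
      rw [ENNReal.coe_div (by norm_num)]
      simp_rw [div_eq_mul_inv, ← mul_assoc]
      rw [ENNReal.tsum_mul_right]
      push_cast
      simp_rw [mul_add, add_mul _ (1 : ℝ≥0∞), one_mul, ENNReal.tsum_add]
      rw [ih s (by omega), ih (s + 1) (by omega), ih (s + 2) (by omega), ih (s + 3) (by omega),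
        ih (s + 4) (by omega), ih (s + 5) (by omega)]
      simp_rw [tsum_measure_aliveAt hmeas hindep hunif]
      congr 1
      ring

theorem tsum_measure_noPrime [IsProbabilityMeasure μ]
    (hmeas : ∀ i, Measurable (X i)) (hindep : iIndepFun X μ)
    (hunif : ∀ i, μ.map (X i) = uniformOn (Set.Icc 1 6)) :
    ∑' n, μ (noPrime X n) = ∑' s, (aliveMass s : ℝ≥0∞) ∧
    ∑' n : ℕ, (2 * n + 1) * μ (noPrime X n) =
      ∑' s, ((2 * aliveMoment s + aliveMass s : ℝ≥0) : ℝ≥0∞) := by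
  have h : ∀ n, μ (noPrime X n) = ∑' s, μ (aliveAt X n s) := fun n => by
    rw [noPrime_eq_iUnion_aliveAt]
    refine measure_iUnion (fun s t hst => Set.disjoint_left.2 fun ω h1 h2 => hst ?_)
      (measurableSet_aliveAt hmeas n)
    exact h1.2.symm.trans h2.2
  constructor
  · simp_rw [h]
    rw [ENNReal.tsum_comm]
    simp_rw [tsum_measure_aliveAt hmeas hindep hunif]
  · simp_rw [h, ← ENNReal.tsum_mul_left]
    rw [ENNReal.tsum_comm]
    simp_rw [add_mul, one_mul, mul_assoc, ENNReal.tsum_add, ENNReal.tsum_mul_left,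
      tsum_measure_aliveAt hmeas hindep hunif, tsum_mul_measure_aliveAt hmeas hindep hunif]
    push_cast
    rw [ENNReal.tsum_add, ENNReal.tsum_mul_left]

/-! ### Moments of `τ` from its tail probabilities -/

theorem ae_primeHit_ne_top (hfin : ∑' n, μ (noPrime X n) ≠ ⊤) :
    ∀ᵐ ω ∂μ, primeHit X ω ≠ ⊤ := by
  rw [ae_iff]
  by_contra h
  refine hfin (top_unique ?_)
  -- Each term is at least `P(τ = ∞)`, so a positive value would make the sum infinite.
  rw [← ENNReal.tsum_const_eq_top_of_ne_zero (α := ℕ) h]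
  refine ENNReal.tsum_le_tsum fun n => measure_mono fun ω hω => ?_
  rw [Set.mem_ofPred_eq, not_not] at hω
  rw [mem_noPrime_iff_lt_primeHit, hω]
  exact ENat.natCast_lt_top n

theorem lintegral_tsum_indicator_noPrime (hmeas : ∀ i, Measurable (X i)) (c : ℕ → ℝ≥0∞) :
    ∫⁻ ω, ∑' n, c n * (noPrime X n).indicator 1 ω ∂μ = ∑' n, c n * μ (noPrime X n) := by
  have hm : ∀ n, Measurable ((noPrime X n).indicator (1 : Ω → ℝ≥0∞)) := fun n =>
    measurable_one.indicator (measurableSet_noPrime hmeas n)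
  rw [lintegral_tsum fun n => ((hm n).const_mul _).aemeasurable]
  simp_rw [lintegral_const_mul _ (hm _), lintegral_indicator_one (measurableSet_noPrime hmeas _)]

/-- If `∑ (2n + 1) P(τ > n)` is finite, then it is the second moment of `τ`, and `∑ P(τ > n)` is
the mean. -/
theorem moments_primeHitReal (hmeas : ∀ i, Measurable (X i))
    {A B : ℝ≥0} (hA : ∑' n, μ (noPrime X n) = A)
    (hB : ∑' n : ℕ, (2 * n + 1) * μ (noPrime X n) = B) :
    MemLp (primeHitReal X) 2 μ ∧ μ[primeHitReal X] = (A : ℝ) ∧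
      μ[primeHitReal X ^ 2] = (B : ℝ) := by
  have hae := ae_primeHit_ne_top (μ := μ) (X := X) (hA ▸ ENNReal.coe_ne_top)
  have h1 : ∀ᵐ ω ∂μ, ENNReal.ofReal (primeHitReal X ω) =
      ∑' n, 1 * (noPrime X n).indicator 1 ω := by
    filter_upwards [hae] with ω hω
    rw [tsum_indicator_noPrime (fun _ => 1) hω]
    simp [primeHitReal]
  have h2 : ∀ᵐ ω ∂μ, ENNReal.ofReal (primeHitReal X ω ^ 2) =
      ∑' n : ℕ, (2 * (n : ℝ≥0∞) + 1) * (noPrime X n).indicator 1 ω := by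
    filter_upwards [hae] with ω hω
    rw [tsum_indicator_noPrime (fun n : ℕ => 2 * (n : ℝ≥0∞) + 1) hω, sum_range_two_mul_add_one,
      primeHitReal, ENNReal.ofReal_pow (Nat.cast_nonneg _), ENNReal.ofReal_natCast]
  have hnn : ∀ ω, 0 ≤ primeHitReal X ω := fun ω => Nat.cast_nonneg _
  have hmeas' : AEStronglyMeasurable (primeHitReal X) μ := by
    have hm : Measurable fun ω => ∑' n, 1 * (noPrime X n).indicator (1 : Ω → ℝ≥0∞) ω :=
      Measurable.tsum fun n =>
        (measurable_one.indicator (measurableSet_noPrime hmeas n)).const_mul _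
    refine (hm.ennreal_toReal.aemeasurable.congr ?_).aestronglyMeasurable
    filter_upwards [h1] with ω hω
    rw [← hω, ENNReal.toReal_ofReal (hnn ω)]
  have i1 : ∫⁻ ω, ENNReal.ofReal (primeHitReal X ω) ∂μ = A := by
    rw [lintegral_congr_ae h1, lintegral_tsum_indicator_noPrime hmeas fun _ => 1]
    simpa using hA
  have i2 : ∫⁻ ω, ENNReal.ofReal (primeHitReal X ω ^ 2) ∂μ = B := by
    rw [lintegral_congr_ae h2,
      lintegral_tsum_indicator_noPrime hmeas fun n : ℕ => 2 * (n : ℝ≥0∞) + 1, hB]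
  refine ⟨?_, ?_, ?_⟩
  · rw [memLp_two_iff_integrable_sq hmeas']
    refine ⟨hmeas'.pow 2, ?_⟩
    rw [hasFiniteIntegral_iff_ofReal (ae_of_all _ fun ω => sq_nonneg _), i2]
    exact ENNReal.coe_lt_top
  · rw [integral_eq_lintegral_of_nonneg_ae (ae_of_all _ hnn) hmeas', i1, ENNReal.coe_toReal]
  · simp only [Pi.pow_apply]
    rw [integral_eq_lintegral_of_nonneg_ae (ae_of_all _ fun ω => sq_nonneg _) (hmeas'.pow 2), i2,
      ENNReal.coe_toReal]

end Walk

theorem mainTheorem1 {Ω : Type*} [MeasurableSpace Ω] (μ : Measure Ω) [IsProbabilityMeasure μ]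
    (X : ℕ → Ω → ℕ) (hmeas : ∀ i, Measurable (X i)) (hindep : iIndepFun X μ)
    (hunif : ∀ i, μ.map (X i) = uniformOn (Set.Icc 1 6)) :
    (∀ᵐ ω ∂μ, primeHit X ω ≠ ⊤) ∧
    MemLp (primeHitReal X) 2 μ ∧
    |μ[primeHitReal X] - 2.428497913693504| < 1 / 10 ^ 7 ∧
    μ[primeHitReal X] ∈ Set.Ico (2.42849 : ℝ) 2.42850 ∧
    |variance (primeHitReal X) μ - 6.242778668279075| < 1 / 10 ^ 4 ∧
    variance (primeHitReal X) μ ∈ Set.Ico (6.2427 : ℝ) 6.2428 := by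
  obtain ⟨hA, hB⟩ := tsum_measure_noPrime hmeas hindep hunif
  obtain ⟨sA, bA⟩ := tsum_aliveMass_bounds
  obtain ⟨sB, bB⟩ := tsum_two_mul_aliveMoment_add_bounds
  rw [← ENNReal.coe_tsum sA] at hA
  rw [← ENNReal.coe_tsum sB] at hB
  obtain ⟨hL, h1, h2⟩ := moments_primeHitReal hmeas hA hB
  rw [variance_eq_sub hL, h1, h2]
  push_cast
  set A := ∑' t, (aliveMass t : ℝ)
  set B := ∑' t, (2 * aliveMoment t + aliveMass t : ℝ)
  obtain ⟨a1, a2⟩ := abs_le.1 bA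
  obtain ⟨b1, b2⟩ := abs_le.1 bB
  -- The endpoints are `2.428497913693504 ∓ 2 / 10 ^ 8`, rounded outwards; they control the square
  -- of the mean in the variance.
  have q1 : (2.428497893 : ℝ) ^ 2 ≤ A ^ 2 := by gcongr; linarith
  have q2 : A ^ 2 ≤ (2.428497934 : ℝ) ^ 2 := by
    gcongr
    linarith
  norm_num at q1 q2
  refine ⟨ae_primeHit_ne_top (hA ▸ ENNReal.coe_ne_top), hL, ?_, ⟨?_, ?_⟩, ?_, ⟨?_, ?_⟩⟩
  · rw [abs_lt]; constructor <;> linarith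
  · linarith
  · linarith
  · rw [abs_lt]; constructor <;> linarith
  · linarith
  · linarith
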